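/- Let $n\ge 0$ be an integer. A partial order $P$ on a set is an \emph{interval order} if each element $z$ can be assigned a nonempty closed real interval $[l_z,r_z]$ such that $x<_P y$ if and only if $r_x<l_y$. A labeled interval order on $[n]=\{1,\dots,n\}$ is a partial order on the set $[n]$ that is an interval order; two of them are regarded as the same only if they are equal as relations. Then the number of labeled interval orders on $[n]$ is $$\sum_{\{s_1<\dots<s_k\}\subseteq\{1,\dots,n-1\}}\left(\det\left[\binom{n-s_i}{s_{j+1}-s_i}\right]_{0\le i,j\le k}\cdot\prod_{r=1}^{k+1} r^{\,s_r-s_{r-1}}\right),$$ where the sum is over all subsets of $\{1,\dots,n-1\}$ (including the empty one, $k=0$; for $n=0$ the empty set is the only subset), $s_0=0$, $s_{k+1}=n$, and $\binom{m}{a}=0$ for $a<0$. -/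

import Mathlib

/-- A partial order `P` on `α` is an interval order if every `z` can be assigned a (nonempty)
closed real interval `[l z, r z]` such that `x <_P y` if and only if `r x < l y`. -/
def IsIntervalOrder {α : Type*} (P : PartialOrder α) : Prop :=
  ∃ l r : α → ℝ, (∀ z, l z ≤ r z) ∧ ∀ x y, P.lt x y ↔ r x < l y

/-- For `S = {s₁ < ⋯ < s_k}`, the sequence with `s₀ = 0`, then `s₁, …, s_k`, and
`s_{k+1} = n` (the value at indices beyond `k + 1` is never used). -/
def extSeq (n : ℕ) (S : Finset ℕ) : ℕ → ℕ
  | 0 => 0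
  | i + 1 => if h : i < S.card then S.orderEmbOfFin rfl ⟨i, h⟩ else n

/-- The binomial coefficient with lower entry `b - a`, equal to `0` when `b - a` is negative. -/
def chooseDiff (m b a : ℕ) : ℤ :=
  if a ≤ b then (m.choose (b - a) : ℤ) else 0

/-- The `(k+1) × (k+1)` matrix, rows and columns indexed by `0, …, k`, with entries
`binom (n - s_i) (s_{j+1} - s_i)`. -/
def binomMatrix (n : ℕ) (S : Finset ℕ) : Matrix (Fin (S.card + 1)) (Fin (S.card + 1)) ℤ :=
  Matrix.of fun i j =>
    chooseDiff (n - extSeq n S i) (extSeq n S (j + 1)) (extSeq n S i)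

/-! Both sides equal `n! [x^n] ∑_K ∏_{r=1}^K (1 - e^{-rx})`.

An interval order has exactly one representation by intervals `[p x, q x]` in `ℕ` in which left and
right endpoints fill the same initial segment; these are the staircase placements with `v = 0`
(`card_isIntervalOrder`). Deleting column 0 turns row `v` into a free row, subject only to its being
in use; inclusion–exclusion on that condition (`card_first_column`) relates `v` to `v + 1`. If `F_v`
is the exponential generating function and `G_v = e^{vx} F_v`, this says `G_v = 1 + (1 -
e^{-(v+1)x}) G_{v+1}`, and iteration from `v = 0` gives the series.

On the other side, each determinant obeys a two-term recursion in its first column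
(`binomDet_cons`). Summed over `S`, it becomes a difference equation in the initial weight `v`
(`detSum_succ`), diagonal up to a shift in the rising factorials of `v`. The coefficients at `v = 1`
are those of the same products (`factorial_mul_detCoeff`). -/

/-- `p` (rows) and `q` (columns) place each element of `α` in a cell of a staircase with `v` free
rows: column `j` has rows `0, …, v + j`, the columns in use form an initial segment of `ℕ`, and the
row `v + j` is in use for every column `j` in use. -/
structure IsStaircase {α : Type*} (v : ℕ) (p q : α → ℕ) : Prop where
  row_le : ∀ x, p x ≤ v + q x
  exists_column : ∀ x, ∀ j < q x, ∃ y, q y = j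
  exists_row : ∀ x, ∃ y, p y = v + q x

/-- The staircase placements of `α` with `v` free rows. -/
abbrev Staircase (α : Type*) (v : ℕ) : Type _ :=
  {f : (α → ℕ) × (α → ℕ) // IsStaircase v f.1 f.2}

/-! ### Canonical representations of interval orders -/

/-- The strict order `q x < p y` of the intervals `[p x, q x]`. -/
@[reducible] def intervalPartialOrder {α : Type*} (p q : α → ℕ) (h : ∀ x, p x ≤ q x) : PartialOrder α where
  le x y := x = y ∨ q x < p y
  lt x y := q x < p y
  le_refl x := Or.inl rfl
  le_trans x y z := by
    rintro (rfl | hxy) (rfl | hyz)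
    · exact Or.inl rfl
    · exact Or.inr hyz
    · exact Or.inr hxy
    · exact Or.inr (hxy.trans_le ((h y).trans hyz.le))
  le_antisymm x y := by
    rintro (rfl | hxy) (hyx | hyx)
    · rfl
    · rfl
    · exact hyx.symm
    · have := h x; have := h y; omega
  lt_iff_le_not_ge x y := by
    have := h x; have := h y
    constructor
    · intro hxy
      refine ⟨Or.inr hxy, ?_⟩
      rintro (rfl | hyx) <;> omega
    · rintro ⟨rfl | hxy, hn⟩
      · exact absurd (Or.inl rfl) hn
      · exact hxy

theorem eq_of_lt_iff_lt_of_initial {α : Type*} {p p' : α → ℕ}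
    (hp : ∀ x, ∀ j < p x, ∃ y, p y = j) (hp' : ∀ x, ∀ j < p' x, ∃ y, p' y = j)
    (h : ∀ y z, p y < p z ↔ p' y < p' z) : p = p' := by
  funext z
  induction hz : p z using Nat.strong_induction_on generalizing z with
  | _ m ih =>
    subst hz
    rcases lt_trichotomy (p z) (p' z) with hlt | heq | hlt
    · obtain ⟨y, hy⟩ := hp' z _ hlt
      have h1 : p y < p z := (h y z).2 (by omega)
      have := ih _ h1 y rfl
      omega
    · exact heq
    · obtain ⟨y, hy⟩ := hp z _ hlt
      have h1 : p y < p z := by omega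
      have := ih _ h1 y rfl
      have := (h y z).1 h1
      omega

namespace IsStaircase

variable {α : Type*} {p q p' q' : α → ℕ}

theorem row_le_column (h : IsStaircase 0 p q) (x : α) : p x ≤ q x := by
  simpa using h.row_le x

theorem exists_row_eq (h : IsStaircase 0 p q) (x : α) : ∀ j < p x, ∃ y, p y = j := by
  intro j hj
  obtain ⟨y, hy⟩ := h.exists_column x j (hj.trans_le (h.row_le_column x))
  obtain ⟨z, hz⟩ := h.exists_row y
  exact ⟨z, by omega⟩

/-- The order of the rows is visible in the interval order: column `p y` is in use as soon as `p y <
p z ≤ q z`, and an interval ending there separates `y` from `z`. -/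
theorem row_lt_row_iff (h : IsStaircase 0 p q) (y z : α) :
    p y < p z ↔ ∃ x, q x < p z ∧ ¬ q x < p y := by
  constructor
  · intro hyz
    obtain ⟨x, hx⟩ := h.exists_column z (p y) (hyz.trans_le (h.row_le_column z))
    exact ⟨x, by omega, by omega⟩
  · rintro ⟨x, h1, h2⟩
    omega

theorem column_le (h' : IsStaircase 0 p q')
    (hlt : ∀ x y, q x < p y ↔ q' x < p y) (x : α) : q' x ≤ q x := by
  by_contra! hx
  obtain ⟨z, hz⟩ := h'.exists_row x
  have := hlt x z
  omega

theorem eq_of_lt_iff (h : IsStaircase 0 p q) (h' : IsStaircase 0 p' q')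
    (hlt : ∀ x y, q x < p y ↔ q' x < p' y) : p = p' ∧ q = q' := by
  obtain rfl : p = p' := eq_of_lt_iff_lt_of_initial h.exists_row_eq h'.exists_row_eq fun y z => by
    rw [h.row_lt_row_iff, h'.row_lt_row_iff]
    simp only [hlt]
  refine ⟨rfl, funext fun x => le_antisymm ?_ (column_le h' hlt x)⟩
  exact column_le h (fun x y => (hlt x y).symm) x

end IsStaircase

/-- Predecessor sets form a chain, so their sizes `k` order them by inclusion. The left endpoint of
`y` is the rank of `k y`, the right endpoint of `x` the rank of the largest `k y` with `y` not above
`x`. -/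
theorem IsIntervalOrder.exists_isStaircase {α : Type*} [Fintype α] {P : PartialOrder α}
    (hP : IsIntervalOrder P) :
    ∃ p q : α → ℕ, IsStaircase 0 p q ∧ ∀ x y, P.lt x y ↔ q x < p y := by
  classical
  obtain ⟨l, r, hlr, hlt⟩ := hP
  have irr : ∀ x, ¬ P.lt x x := fun x => by rw [hlt]; exact not_lt.2 (hlr x)
  let k : α → ℕ := fun y => (Finset.univ.filter fun x => P.lt x y).card
  have hk : ∀ y z, k y < k z ↔ ∃ x, P.lt x z ∧ ¬ P.lt x y := by
    intro y z
    constructor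
    · intro h
      by_contra! hn
      refine h.not_ge (Finset.card_le_card fun x hx => ?_)
      simp only [Finset.mem_filter, Finset.mem_univ, true_and] at hx ⊢
      exact hn x hx
    · rintro ⟨x, hxz, hxy⟩
      refine Finset.card_lt_card (Finset.ssubset_iff_of_subset ?_ |>.2 ⟨x, by simpa, by simp [hxy]⟩)
      intro w hw
      simp only [Finset.mem_filter, Finset.mem_univ, true_and, hlt] at *
      -- Here `r w < l y ≤ r x < l z`, so predecessors of `y` precede `z`.
      linarith
  let M : α → ℕ := fun x => (Finset.univ.filter fun y => ¬ P.lt x y).sup k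
  have hMk : ∀ x, ∃ y, ¬ P.lt x y ∧ M x = k y := by
    intro x
    obtain ⟨y, hy, h⟩ := Finset.exists_mem_eq_sup (Finset.univ.filter fun y => ¬ P.lt x y)
      ⟨x, by simp⟩ k
    exact ⟨y, by simpa using hy, h⟩
  have hM : ∀ x y, ¬ P.lt x y → k y ≤ M x := fun x y h =>
    Finset.le_sup (f := k) (by simpa using h)
  have hMlt : ∀ x y, P.lt x y ↔ M x < k y := by
    intro x y
    constructor
    · intro h
      obtain ⟨z, hz, he⟩ := hMk x
      rw [he, hk]
      exact ⟨x, h, hz⟩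
    · intro h
      by_contra hn
      exact (hM x y hn).not_gt h
  let L : ℕ → Prop := fun t => ∃ x, k x = t
  have hstrict : ∀ s t, L s → (Nat.count L s < Nat.count L t ↔ s < t) := fun s t hs =>
    ⟨fun h => lt_of_not_ge fun hts => (Nat.count_monotone L hts).not_gt h,
      fun h => Nat.count_strict_mono hs h⟩
  have hLM : ∀ x, L (M x) := fun x => by
    obtain ⟨y, -, h⟩ := hMk x
    exact ⟨y, h.symm⟩
  refine ⟨fun x => Nat.count L (k x), fun x => Nat.count L (M x), ⟨?_, ?_, ?_⟩, ?_⟩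
  · intro x
    rw [zero_add]
    exact Nat.count_monotone L (hM x x (irr x))
  · intro x j hj
    have hfin : ∀ hf : {t | L t}.Finite, j < hf.toFinset.card := fun hf => by
      refine hj.trans_le ?_
      rw [Nat.count_eq_card_filter_range]
      refine Finset.card_le_card fun t ht => ?_
      simpa using (Finset.mem_filter.1 ht).2
    obtain ⟨z, hz⟩ : L (Nat.nth L j) := Nat.nth_mem j hfin
    have hcount : Nat.count L (Nat.nth L j) = j := Nat.count_nth hfin
    have hzx : k z < M x := by
      rw [← hstrict _ _ ⟨z, rfl⟩, hz, hcount]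
      exact hj
    obtain ⟨w₀, -, hw₀⟩ := hMk x
    -- `w` attains the next value of `k` after `k z`. A predecessor `y` of `w` but not of `z` has `k
    -- z ≤ M y < k w`, and `M y` is a value of `k`, so `M y = k z`.
    obtain ⟨w, hw, hmin⟩ := Finset.exists_min_image (Finset.univ.filter fun w => k z < k w) k
      ⟨w₀, by simpa [← hw₀] using hzx⟩
    simp only [Finset.mem_filter, Finset.mem_univ, true_and] at hw hmin
    obtain ⟨y, hyw, hyz⟩ := (hk z w).1 hw
    refine ⟨y, ?_⟩
    have h1 := (hMlt y w).1 hyw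
    have h2 := hM y z hyz
    obtain ⟨u, -, hu⟩ := hMk y
    have h3 : M y = k z := by
      by_contra hne
      have := hmin u (by omega)
      omega
    simp only [h3, hz, hcount]
  · intro x
    obtain ⟨y, -, h⟩ := hMk x
    exact ⟨y, by simp [h]⟩
  · intro x y
    rw [hstrict _ _ (hLM x), hMlt]

theorem card_isIntervalOrder {α : Type*} [Fintype α] :
    Nat.card {P : PartialOrder α // IsIntervalOrder P} = Nat.card (Staircase α 0) := by
  symm
  refine Nat.card_eq_of_bijective
    (fun f => ⟨intervalPartialOrder f.1.1 f.1.2 f.2.row_le_column,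
      fun x => f.1.1 x, fun x => f.1.2 x, fun x => Nat.cast_le.2 (f.2.row_le_column x),
      fun x y => (Nat.cast_lt (α := ℝ)).symm⟩) ⟨?_, ?_⟩
  · rintro ⟨⟨p, q⟩, h⟩ ⟨⟨p', q'⟩, h'⟩ heq
    have heq' := Subtype.ext_iff.1 heq
    have := h.eq_of_lt_iff h' fun x y =>
      iff_of_eq (congrArg (fun P : PartialOrder α => P.lt x y) heq')
    exact Subtype.ext (Prod.ext this.1 this.2)
  · rintro ⟨P, hP⟩
    obtain ⟨p, q, h, hlt⟩ := hP.exists_isStaircase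
    refine ⟨⟨(p, q), h⟩, Subtype.ext (PartialOrder.ext fun x y => ?_)⟩
    change x = y ∨ q x < p y ↔ P.le x y
    rw [← hlt]
    exact (@le_iff_eq_or_lt _ P x y).symm

/-! ### Counting staircase placements by their first column -/

theorem IsStaircase.column_lt {α : Type*} [Fintype α] {v : ℕ} {p q : α → ℕ}
    (h : IsStaircase v p q) (x : α) : q x < Fintype.card α := by
  classical
  have hsub : Finset.range (q x + 1) ⊆ Finset.univ.image q := by
    intro j hj
    rcases Nat.lt_succ_iff_lt_or_eq.1 (Finset.mem_range.1 hj) with h1 | rfl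
    · simpa using h.exists_column x j h1
    · simp
  have := (Finset.card_le_card hsub).trans Finset.card_image_le
  simpa using this

instance {α : Type*} [Fintype α] {v : ℕ} : Finite (Staircase α v) := by
  refine Finite.of_injective (β := (α → Fin (v + Fintype.card α)) × (α → Fin (Fintype.card α)))
    (fun f => (fun x => ⟨f.1.1 x, ?_⟩, fun x => ⟨f.1.2 x, f.2.column_lt x⟩)) ?_
  · have := f.2.column_lt x
    have := f.2.row_le x
    omega
  · rintro ⟨⟨p, q⟩, h⟩ ⟨⟨p', q'⟩, h'⟩ heq
    simp only [Prod.mk.injEq, funext_iff, Fin.mk.injEq] at heq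
    exact Subtype.ext (Prod.ext (funext heq.1) (funext heq.2))

theorem IsStaircase.comp_equiv {α β : Type*} {v : ℕ} {p q : α → ℕ} (h : IsStaircase v p q)
    (e : β ≃ α) : IsStaircase v (p ∘ e) (q ∘ e) where
  row_le x := h.row_le (e x)
  exists_column x j hj := by
    obtain ⟨y, hy⟩ := h.exists_column (e x) j hj
    exact ⟨e.symm y, by simpa using hy⟩
  exists_row x := by
    obtain ⟨y, hy⟩ := h.exists_row (e x)
    exact ⟨e.symm y, by simpa using hy⟩

/-- The number of staircase placements of `n` elements with `v` free rows. -/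
noncomputable def staircaseCount (n v : ℕ) : ℕ := Nat.card (Staircase (Fin n) v)

theorem card_staircase (α : Type*) [Fintype α] (v : ℕ) :
    Nat.card (Staircase α v) = staircaseCount (Fintype.card α) v := by
  let e := Fintype.equivFin α
  refine Nat.card_congr
    { toFun := fun f => ⟨(f.1.1 ∘ e.symm, f.1.2 ∘ e.symm), f.2.comp_equiv e.symm⟩
      invFun := fun f => ⟨(f.1.1 ∘ e, f.1.2 ∘ e), f.2.comp_equiv e⟩
      left_inv := fun f => ?_
      right_inv := fun f => ?_ }
  · exact Subtype.ext (Prod.ext (funext fun x => by simp) (funext fun x => by simp))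
  · exact Subtype.ext (Prod.ext (funext fun x => by simp) (funext fun x => by simp))

section FirstColumn

variable {α : Type*} [Fintype α] [DecidableEq α] (B : Finset α) (v : ℕ)

/-- A placement of `B` in the first `v + 1` rows, with a staircase placement of the other
elements. -/
abbrev SplitStaircase : Type _ := (B → Fin v) × Staircase {x // x ∉ B} v

variable {B v}

/-- Whether the last free row is in use. -/
def SplitStaircase.HitsLast (w : SplitStaircase B (v + 1)) : Prop :=
  (∃ b, w.1 b = Fin.last v) ∨ ∃ x, w.2.1.1 x = v

variable (B v)

/-- Deleting column 0 lowers the other columns by one and makes row `v` free. The one condition lost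
is that row `v` be in use; `HitsLast` restores it. -/
theorem card_hitsLast (hB : B.Nonempty) :
    Nat.card {f : Staircase α v // Finset.univ.filter (fun x => f.1.2 x = 0) = B} =
      Nat.card {w : SplitStaircase B (v + 1) // w.HitsLast} := by
  have key : ∀ (f : Staircase α v), Finset.univ.filter (fun x => f.1.2 x = 0) = B →
      ∀ x, f.1.2 x = 0 ↔ x ∈ B := by
    rintro f rfl x
    simp
  obtain ⟨b₀, hb₀⟩ := hB
  refine Nat.card_eq_of_bijective (fun f => ⟨(fun b => ⟨f.1.1.1 b, ?_⟩,
    ⟨(fun x => f.1.1.1 x, fun x => f.1.1.2 x - 1), ?_, ?_, ?_⟩), ?_⟩) ⟨?_, ?_⟩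
  · have h1 := f.1.2.row_le b
    have h2 := (key _ f.2 b).2 b.2
    omega
  · intro x
    have h1 := f.1.2.row_le x
    have h2 := mt (key _ f.2 x).1 x.2
    dsimp only
    omega
  · intro x j hj
    dsimp only at hj
    obtain ⟨y, hy⟩ := f.1.2.exists_column x (j + 1) (by omega)
    exact ⟨⟨y, fun hyB => by have := (key _ f.2 y).2 hyB; omega⟩, by simp [hy]⟩
  · intro x
    have h2 := mt (key _ f.2 x).1 x.2
    obtain ⟨y, hy⟩ := f.1.2.exists_row x
    refine ⟨⟨y, fun hyB => ?_⟩, ?_⟩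
    · have h1 := f.1.2.row_le y
      have := (key _ f.2 y).2 hyB
      omega
    · dsimp only
      omega
  · obtain ⟨y, hy⟩ := f.1.2.exists_row b₀
    rw [(key _ f.2 b₀).2 hb₀, add_zero] at hy
    by_cases hyB : y ∈ B
    · exact Or.inl ⟨⟨y, hyB⟩, Fin.ext hy⟩
    · exact Or.inr ⟨⟨y, hyB⟩, hy⟩
  · rintro ⟨⟨⟨p, q⟩, h⟩, hf⟩ ⟨⟨⟨p', q'⟩, h'⟩, hf'⟩ heq
    have k1 := key _ hf
    have k2 := key _ hf'
    simp only [Subtype.mk.injEq, Prod.mk.injEq, funext_iff, Fin.mk.injEq, Subtype.forall] at heq k1 k2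
    obtain ⟨e1, e2, e3⟩ := heq
    refine Subtype.ext (Subtype.ext (Prod.ext (funext fun x => ?_) (funext fun x => ?_)))
    · by_cases hx : x ∈ B
      · exact e1 x hx
      · exact e2 x hx
    · by_cases hx : x ∈ B
      · exact ((k1 x).2 hx).trans ((k2 x).2 hx).symm
      · have := e3 x hx
        have := mt (k1 x).1 hx
        have := mt (k2 x).1 hx
        dsimp only
        omega
  · rintro ⟨⟨g, ⟨⟨p, q⟩, h⟩⟩, hit⟩
    let P : α → ℕ := fun x => if hx : x ∈ B then g ⟨x, hx⟩ else p ⟨x, hx⟩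
    let Q : α → ℕ := fun x => if hx : x ∈ B then 0 else q ⟨x, hx⟩ + 1
    have hPB : ∀ b : B, P b = g b := fun b => dif_pos b.2
    have hPC : ∀ x : {x // x ∉ B}, P x = p x := fun x => dif_neg x.2
    have hQB : ∀ b ∈ B, Q b = 0 := fun b hb => dif_pos hb
    have hQC : ∀ x : {x // x ∉ B}, Q x = q x + 1 := fun x => dif_neg x.2
    have hPQ : IsStaircase v P Q := by
      refine ⟨fun x => ?_, fun x j hj => ?_, fun x => ?_⟩
      · by_cases hx : x ∈ B
        · rw [hPB ⟨x, hx⟩]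
          omega
        · rw [hPC ⟨x, hx⟩, hQC ⟨x, hx⟩]
          have := h.row_le ⟨x, hx⟩
          dsimp only at this
          omega
      · by_cases hx : x ∈ B
        · rw [hQB x hx] at hj
          omega
        · rw [hQC ⟨x, hx⟩] at hj
          cases j with
          | zero => exact ⟨b₀, hQB b₀ hb₀⟩
          | succ j =>
            obtain ⟨y, hy⟩ := h.exists_column ⟨x, hx⟩ j (by dsimp only; omega)
            exact ⟨y, by rw [hQC]; exact congrArg (· + 1) hy⟩
      · by_cases hx : x ∈ B
        · rw [hQB x hx]
          rcases hit with ⟨b, hb⟩ | ⟨y, hy⟩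
          · exact ⟨b, by rw [hPB]; exact congrArg Fin.val hb⟩
          · exact ⟨y, by rw [hPC]; exact hy⟩
        · obtain ⟨y, hy⟩ := h.exists_row ⟨x, hx⟩
          refine ⟨y, ?_⟩
          rw [hPC, hQC ⟨x, hx⟩]
          dsimp only at hy
          omega
    refine ⟨⟨⟨(P, Q), hPQ⟩, ?_⟩, ?_⟩
    · ext x
      simp only [Finset.mem_filter, Finset.mem_univ, true_and]
      refine ⟨fun h0 => ?_, hQB x⟩
      by_contra hx
      rw [hQC ⟨x, hx⟩] at h0
      omega
    · refine Subtype.ext (Prod.ext (funext fun b => Fin.ext (hPB b))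
        (Subtype.ext (Prod.ext (funext hPC) (funext fun x => ?_))))
      simp only [hQC, Nat.add_sub_cancel]

omit [Fintype α] [DecidableEq α] in
-- An unused row `v` can be deleted, and conversely an empty row inserted there.
theorem card_not_hitsLast :
    Nat.card {w : SplitStaircase B (v + 1) // ¬ w.HitsLast} = Nat.card (SplitStaircase B v) := by
  symm
  refine Nat.card_eq_of_bijective (fun w => ⟨(fun b => (w.1 b).castSucc,
    ⟨(fun x => if w.2.1.1 x < v then w.2.1.1 x else w.2.1.1 x + 1, w.2.1.2), ?_, ?_, ?_⟩), ?_⟩)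
    ⟨?_, ?_⟩
  · intro x
    have := w.2.2.row_le x
    dsimp only
    split_ifs <;> omega
  · exact w.2.2.exists_column
  · intro x
    obtain ⟨y, hy⟩ := w.2.2.exists_row x
    refine ⟨y, ?_⟩
    dsimp only
    rw [if_neg (by omega)]
    omega
  · rintro (⟨b, hb⟩ | ⟨x, hx⟩)
    · exact (Fin.castSucc_lt_last _).ne hb
    · dsimp only at hx
      split_ifs at hx <;> omega
  · rintro ⟨g, ⟨⟨p, q⟩, h⟩⟩ ⟨g', ⟨⟨p', q'⟩, h'⟩⟩ heq
    simp only [Subtype.mk.injEq, Prod.mk.injEq, funext_iff, Fin.castSucc_inj] at heq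
    obtain ⟨e1, e2, e3⟩ := heq
    refine Prod.ext (funext e1) (Subtype.ext (Prod.ext (funext fun x => ?_) (funext e3)))
    have := e2 x
    dsimp only
    split_ifs at this <;> omega
  · rintro ⟨⟨g, ⟨⟨p, q⟩, h⟩⟩, hit⟩
    simp only [SplitStaircase.HitsLast, not_or, not_exists] at hit
    obtain ⟨hg, hp⟩ := hit
    refine ⟨(fun b => (g b).castLT ?_, ⟨(fun x => if p x < v then p x else p x - 1, q), ?_, ?_, ?_⟩),
      ?_⟩
    · exact Fin.val_lt_last (hg b)
    · intro x
      have := h.row_le x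
      dsimp only at this ⊢
      split_ifs <;> omega
    · exact h.exists_column
    · intro x
      obtain ⟨y, hy⟩ := h.exists_row x
      refine ⟨y, ?_⟩
      dsimp only at hy ⊢
      rw [if_neg (by omega)]
      omega
    · refine Subtype.ext (Prod.ext (funext fun b => Fin.ext rfl)
        (Subtype.ext (Prod.ext (funext fun x => ?_) rfl)))
      have := hp x
      dsimp only
      split_ifs <;> omega

theorem card_splitStaircase :
    Nat.card (SplitStaircase B v) =
      v ^ B.card * staircaseCount (Fintype.card α - B.card) v := by
  rw [Nat.card_prod, card_staircase, Nat.card_fun, Nat.card_eq_fintype_card,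
    Nat.card_eq_fintype_card, Fintype.card_fin, Fintype.card_coe, Fintype.card_subtype_compl,
    Fintype.card_coe]

theorem card_first_column (hB : B.Nonempty) :
    Nat.card {f : Staircase α v // Finset.univ.filter (fun x => f.1.2 x = 0) = B} +
        v ^ B.card * staircaseCount (Fintype.card α - B.card) v =
      (v + 1) ^ B.card * staircaseCount (Fintype.card α - B.card) (v + 1) := by
  classical
  rw [card_hitsLast B v hB, ← card_splitStaircase, ← card_splitStaircase, ← card_not_hitsLast,
    ← Nat.card_sum]
  exact Nat.card_congr (Equiv.sumCompl _)

end FirstColumn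

theorem staircaseCount_zero (v : ℕ) : staircaseCount 0 v = 1 := by
  have : Unique (Staircase (Fin 0) v) :=
    { default := ⟨(fun _ => 0, fun _ => 0), fun x => x.elim0, fun x => x.elim0, fun x => x.elim0⟩
      uniq := fun f => Subtype.ext (Prod.ext (funext fun x => x.elim0) (funext fun x => x.elim0)) }
  exact Nat.card_unique

theorem staircaseCount_eq_sum (n v : ℕ) :
    staircaseCount n v = ∑ B : Finset (Fin n),
      Nat.card {f : Staircase (Fin n) v // Finset.univ.filter (fun x => f.1.2 x = 0) = B} := by
  rw [← Nat.card_sigma]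
  exact Nat.card_congr (Equiv.sigmaFiberEquiv _).symm

theorem card_first_column_empty {n : ℕ} (hn : n ≠ 0) (v : ℕ) :
    Nat.card {f : Staircase (Fin n) v // Finset.univ.filter (fun x => f.1.2 x = 0) = ∅} = 0 := by
  have : IsEmpty {f : Staircase (Fin n) v // Finset.univ.filter (fun x => f.1.2 x = 0) = ∅} := by
    refine ⟨fun ⟨f, hf⟩ => ?_⟩
    have hf' : ∀ x, f.1.2 x ≠ 0 := by simpa [Finset.filter_eq_empty_iff] using hf
    obtain ⟨y, hy⟩ := f.2.exists_column ⟨0, Nat.pos_of_ne_zero hn⟩ 0 (Nat.pos_of_ne_zero (hf' _))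
    exact hf' y hy
  exact Nat.card_of_isEmpty

theorem sum_choose_staircaseCount {n : ℕ} (hn : n ≠ 0) (v : ℕ) :
    ∑ b ∈ Finset.range (n + 1), n.choose b * (v ^ b * staircaseCount (n - b) v) +
        staircaseCount n (v + 1) =
      ∑ b ∈ Finset.range (n + 1),
        n.choose b * ((v + 1) ^ b * staircaseCount (n - b) (v + 1)) := by
  have h : ∀ w, ∑ b ∈ Finset.range (n + 1), n.choose b * (w ^ b * staircaseCount (n - b) w) =
      ∑ B : Finset (Fin n), w ^ B.card * staircaseCount (n - B.card) w := fun w => by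
    have := Finset.sum_powerset_apply_card (fun b => w ^ b * staircaseCount (n - b) w)
      (x := (Finset.univ : Finset (Fin n)))
    simpa using this.symm
  -- `card_first_column` needs `B` nonempty. The two terms at `∅` are `staircaseCount n v`, which is
  -- itself the sum of the first-column counts, and `staircaseCount n (v + 1)`.
  rw [h, h, ← Finset.add_sum_erase _ _ (Finset.mem_univ ∅),
    ← Finset.add_sum_erase _ _ (Finset.mem_univ ∅)]
  have h1 := staircaseCount_eq_sum n v
  rw [← Finset.add_sum_erase _ _ (Finset.mem_univ ∅), card_first_column_empty hn, zero_add] at h1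
  have h2 : ∀ B ∈ (Finset.univ : Finset (Finset (Fin n))).erase ∅, _ := fun B hB =>
    card_first_column B v (Finset.nonempty_iff_ne_empty.2 (Finset.ne_of_mem_erase hB))
  have h3 := Finset.sum_congr rfl h2
  simp only [Fintype.card_fin] at h3
  rw [Finset.sum_add_distrib, ← h1] at h3
  simp only [Finset.card_empty, pow_zero, one_mul, Nat.sub_zero]
  omega

/-! ### Recursion for the determinants -/

/-- The determinant of the `(k + 1) × (k + 1)` matrix with entries
`binom (n - f i) (f (j + 1) - f i)`. -/
def binomDetSeq (n k : ℕ) (f : ℕ → ℕ) : ℤ :=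
  (Matrix.of fun i j : Fin (k + 1) => chooseDiff (n - f i) (f (j + 1)) (f i)).det

theorem binomDetSeq_congr {n k : ℕ} {f g : ℕ → ℕ} (h : ∀ i ≤ k + 1, f i = g i) :
    binomDetSeq n k f = binomDetSeq n k g := by
  unfold binomDetSeq
  congr 1
  ext i j
  simp only [Matrix.of_apply]
  rw [h i (by omega), h (j + 1) (by omega)]

/-- The first column vanishes below row 1, where its entry is 1. Removing row 0 or row 1 with this
column leaves a matrix of the same form, for the sequence without `f 0` or without `f 1`. -/
theorem binomDetSeq_succ {n k : ℕ} {f : ℕ → ℕ} (h₀ : f 0 ≤ f 1)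
    (h : ∀ i ≤ k, f 1 < f (i + 2)) :
    binomDetSeq n (k + 1) f =
      (n - f 0).choose (f 1 - f 0) * binomDetSeq n k (fun i => f (i + 1)) -
        binomDetSeq n k (fun i => if i = 0 then f 0 else f (i + 1)) := by
  unfold binomDetSeq
  rw [Matrix.det_succ_column_zero, Fin.sum_univ_succ, Fin.sum_univ_succ,
    Finset.sum_eq_zero, add_zero, sub_eq_add_neg]
  · congr 1
    · have : chooseDiff (n - f 0) (f 1) (f 0) = ((n - f 0).choose (f 1 - f 0) : ℤ) := if_pos h₀
      simp only [Fin.val_zero, pow_zero, one_mul, Matrix.of_apply, zero_add, this]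
      rfl
    · have : chooseDiff (n - f 1) (f 1) (f 1) = 1 := by simp [chooseDiff]
      simp only [Fin.val_succ, Fin.val_zero, zero_add, pow_one, Matrix.of_apply, this, mul_one,
        neg_one_mul]
      congr 2
      ext i j
      simp only [Matrix.submatrix_apply, Matrix.of_apply]
      cases i using Fin.cases with
      | zero => simp
      | succ i => simp
  · intro i hi
    have : chooseDiff (n - f (i + 2)) (f 1) (f (i + 2)) = 0 := if_neg (by
      have := h i (by omega)
      omega)
    simp only [Fin.val_succ, Fin.val_zero, zero_add, Matrix.of_apply]
    rw [show (i : ℕ) + 1 + 1 = i + 2 from rfl, this]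
    simp

/-- The determinant attached to the sequence `a, l₀, l₁, …, n`. -/
def binomDet (n a : ℕ) (l : List ℕ) : ℤ :=
  binomDetSeq n l.length fun i => (a :: l).getD i n

theorem binomDet_nil {n a : ℕ} (h : a ≤ n) : binomDet n a [] = 1 := by
  simp [binomDet, binomDetSeq, chooseDiff, h]

theorem binomDet_cons {n a s : ℕ} {l : List ℕ} (has : a ≤ s) (hsn : s < n)
    (hsl : ∀ t ∈ l, s < t) :
    binomDet n a (s :: l) = (n - a).choose (s - a) * binomDet n s l - binomDet n a l := by
  unfold binomDet
  rw [List.length_cons, binomDetSeq_succ]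
  · simp only [List.getD_cons_zero, List.getD_cons_succ]
    congr 1
    refine binomDetSeq_congr fun i _ => ?_
    cases i <;> simp
  · simpa using has
  · intro i hi
    simp only [List.getD_cons_succ, List.getD_cons_zero]
    rcases lt_or_ge i l.length with h | h
    · rw [List.getD_eq_getElem _ _ h]
      exact hsl _ (List.getElem_mem h)
    · rwa [List.getD_eq_default _ _ h]

/-- The product of `v ^ (l₀ - a) * (v + 1) ^ (l₁ - l₀) * ⋯`, where `l` is continued by `n`. -/
def stepWeight (n : ℕ) : ℕ → ℕ → List ℕ → ℤ
  | a, v, [] => (v : ℤ) ^ (n - a)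
  | a, v, s :: l => (v : ℤ) ^ (s - a) * stepWeight n s (v + 1) l

theorem prod_range_eq_stepWeight (n a v : ℕ) (l : List ℕ) :
    ∏ r ∈ Finset.range (l.length + 1),
      ((v + r : ℕ) : ℤ) ^ (l.getD r n - (a :: l).getD r n) = stepWeight n a v l := by
  induction l generalizing a v with
  | nil => simp [stepWeight]
  | cons s l ih =>
    rw [List.length_cons, Finset.prod_range_succ', stepWeight, ← ih, mul_comm]
    simp only [List.getD_cons_zero, List.getD_cons_succ, add_zero]
    congr 1
    refine Finset.prod_congr rfl fun r _ => ?_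
    rw [add_assoc, add_comm 1 r]

theorem stepWeight_succ {n a v : ℕ} {l : List ℕ} (ha : a < n) (hl : ∀ t ∈ l, a < t) :
    stepWeight n a v l = v * stepWeight n (a + 1) v l := by
  cases l with
  | nil => rw [stepWeight, stepWeight, ← pow_succ']; congr 1; omega
  | cons s l =>
    have := hl s (by simp)
    rw [stepWeight, stepWeight, ← mul_assoc, ← pow_succ']; congr 2; omega

theorem extSeq_eq_getD (n : ℕ) (S : Finset ℕ) (i : ℕ) :
    extSeq n S i = (0 :: S.sort).getD i n := by
  cases i with
  | zero => rfl
  | succ i =>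
    rw [List.getD_cons_succ, extSeq]
    split_ifs with h
    · rw [List.getD_eq_getElem _ _ (by simpa using h)]
      rfl
    · rw [List.getD_eq_default _ _ (by simpa using h)]

theorem binomMatrix_det (n : ℕ) (S : Finset ℕ) :
    (binomMatrix n S).det = binomDet n 0 S.sort := by
  rw [binomDet, Finset.length_sort]
  simp only [← extSeq_eq_getD]
  rfl

theorem prod_Icc_extSeq (n : ℕ) (S : Finset ℕ) :
    ∏ r ∈ Finset.Icc 1 (S.card + 1), (r : ℤ) ^ (extSeq n S r - extSeq n S (r - 1)) =
      stepWeight n 0 1 S.sort := by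
  rw [← prod_range_eq_stepWeight, Finset.length_sort, ← Finset.Ico_succ_right_eq_Icc,
    Finset.prod_Ico_eq_prod_range]
  refine Finset.prod_congr rfl fun r _ => ?_
  rw [extSeq_eq_getD, extSeq_eq_getD]
  simp [add_comm 1 r]

/-! ### The weighted determinant sum in rising factorials -/

/-- The sum over `S ⊆ {s + 1, …, n - 1}` of the determinants with base `a`, weighted from the
position `s` on starting with the weight `v`. -/
def detSum (n a s v : ℕ) : ℤ :=
  ∑ S ∈ (Finset.Ioo s n).powerset, binomDet n a S.sort * stepWeight n s v S.sort

theorem detSum_self {n a : ℕ} (h : a ≤ n) (v : ℕ) : detSum n a n v = 1 := by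
  simp [detSum, binomDet_nil h, stepWeight]

/-- The subsets split by whether they contain `s + 1`; if so, `binomDet_cons` either moves the base
to `s + 1` or keeps it at `a`, and the weight becomes `v + 1`. -/
theorem detSum_succ {n a s v : ℕ} (has : a ≤ s) (hsn : s < n) :
    detSum n a s v = v * (detSum n a (s + 1) v - detSum n a (s + 1) (v + 1) +
      (n - a).choose (s + 1 - a) * detSum n (s + 1) (s + 1) (v + 1)) := by
  rcases Nat.eq_or_lt_of_le (Nat.succ_le_of_lt hsn) with rfl | h
  · rw [detSum_self (by omega), detSum_self (by omega), detSum_self le_rfl]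
    have : Finset.Ioo s (s + 1) = ∅ := by ext; simp
    simp [detSum, this, binomDet_nil (by omega : a ≤ s + 1), stepWeight]
  · have hI : Finset.Ioo s n = insert (s + 1) (Finset.Ioo (s + 1) n) := by
      ext; simp; omega
    rw [detSum, hI, Finset.sum_powerset_insert (by simp)]
    simp only [detSum, mul_add, mul_sub, Finset.mul_sum]
    rw [sub_add_eq_add_sub, add_sub_assoc, ← Finset.sum_sub_distrib]
    congr 1
    · refine Finset.sum_congr rfl fun S hS => ?_
      have hS' : ∀ t ∈ S.sort, s < t := fun t ht => by
        have := Finset.mem_powerset.1 hS ((Finset.mem_sort _).1 ht)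
        simp at this; omega
      rw [stepWeight_succ hsn hS']
      ring
    · refine Finset.sum_congr rfl fun S hS => ?_
      have hS' : ∀ t ∈ S, s + 1 < t := fun t ht => by
        have := Finset.mem_powerset.1 hS ht
        simp at this; omega
      rw [Finset.sort_insert _ (fun t ht => (hS' t ht).le)
        (fun ht => (hS' _ ht).false),
        binomDet_cons (by omega) (by omega) (by simpa using hS'), stepWeight,
        show s + 1 - s = 1 by omega]
      ring

/-- The coefficients of `detSum` in the basis of rising factorials. -/
def detCoeff : ℕ → ℕ → ℕ → ℤ
  | _, 0, 0 => 1
  | _, 0, _ + 1 => 0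
  | _, _ + 1, 0 => 0
  | n, m + 1, K + 1 => -(K + 1) * detCoeff n m (K + 1) + n.choose m * detCoeff m m K

theorem detCoeff_eq_zero {n m K : ℕ} (h : m < K) : detCoeff n m K = 0 := by
  induction m generalizing n K with
  | zero =>
    obtain ⟨K, rfl⟩ := Nat.exists_eq_succ_of_ne_zero h.ne'
    simp [detCoeff]
  | succ m ih =>
    obtain ⟨K, rfl⟩ := Nat.exists_eq_succ_of_ne_zero (Nat.ne_zero_of_lt h)
    simp [detCoeff, ih (by omega : m < K), ih (by omega : m < K + 1)]

/-- With `v^(K)` the rising factorial, `v (v^(K) - (v+1)^(K)) = -K v^(K)` and `v (v+1)^(K) =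
v^(K+1)`, so `detSum_succ` becomes the recursion of `detCoeff`. The free bound `N` lets the
induction use sums of different lengths. -/
theorem detSum_eq_sum_detCoeff (n : ℕ) {m N s : ℕ} (hm : s + m = n) (hN : m < N) {a : ℕ}
    (has : a ≤ s) (v : ℕ) :
    detSum n a s v = ∑ K ∈ Finset.range N, (v.ascFactorial K : ℤ) * detCoeff (n - a) m K := by
  induction m generalizing N s a v with
  | zero =>
    obtain rfl : s = n := by omega
    rw [detSum_self has, Finset.sum_eq_single 0]
    · simp [detCoeff]
    · intro K _ hK
      rw [detCoeff_eq_zero (by omega), mul_zero]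
    · intro h
      simp at h; omega
  | succ m ih =>
    obtain ⟨N, rfl⟩ := Nat.exists_eq_succ_of_ne_zero (Nat.ne_zero_of_lt hN)
    have hs : s + 1 + m = n := by omega
    have hc : (n - a).choose (s + 1 - a) = (n - a).choose m := by
      rw [← Nat.choose_symm (by omega)]
      congr 1
      omega
    have hnm : n - (s + 1) = m := by omega
    have hstep : ∀ K, (v : ℤ) * ((v + 1).ascFactorial K : ℤ) = (v.ascFactorial (K + 1) : ℤ) := by
      intro K
      rw [Nat.ascFactorial_succ]
      exact_mod_cast Nat.succ_ascFactorial v K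
    rw [detSum_succ has (by omega), ih hs (by omega : m < N + 1) (by omega),
      ih hs (by omega : m < N + 1) (by omega), ih hs (by omega : m < N) le_rfl, hc, hnm,
      ← Finset.sum_sub_distrib, Finset.sum_range_succ', Finset.sum_range_succ']
    simp only [Nat.ascFactorial_zero, Nat.cast_one, one_mul, sub_self, add_zero, detCoeff,
      mul_zero]
    rw [Finset.mul_sum, ← Finset.sum_add_distrib, Finset.mul_sum]
    refine Finset.sum_congr rfl fun K _ => ?_
    have h1 : (v : ℤ) * (v + 1).ascFactorial (K + 1) = (v + (K + 1)) * v.ascFactorial (K + 1) := by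
      rw [hstep, Nat.ascFactorial_succ]
      push_cast
      ring
    have h2 := hstep K
    linear_combination (-detCoeff (n - a) m (K + 1)) * h1 +
      ((n - a).choose m : ℤ) * detCoeff m m K * h2

theorem sum_binomMatrix_det (n : ℕ) :
    ∑ S ∈ (Finset.Icc 1 (n - 1)).powerset, (binomMatrix n S).det *
        ∏ r ∈ Finset.Icc 1 (S.card + 1), (r : ℤ) ^ (extSeq n S r - extSeq n S (r - 1)) =
      ∑ K ∈ Finset.range (n + 1), (K.factorial : ℤ) * detCoeff n n K := by
  have h := detSum_eq_sum_detCoeff n (zero_add n) (Nat.lt_succ_self n) le_rfl 1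
  simp only [Nat.one_ascFactorial, Nat.sub_zero] at h
  rw [← h, detSum]
  have hI : Finset.Icc 1 (n - 1) = Finset.Ioo 0 n := by ext; simp; omega
  rw [hI]
  exact Finset.sum_congr rfl fun S _ => by rw [binomMatrix_det, prod_Icc_extSeq]

theorem detCoeff_succ_eq_sum (n m K : ℕ) :
    detCoeff n m (K + 1) = ∑ j ∈ Finset.range m,
      (-(K + 1 : ℤ)) ^ (m - 1 - j) * n.choose j * detCoeff j j K := by
  induction m with
  | zero => simp [detCoeff]
  | succ m ih =>
    rw [detCoeff, ih, Finset.sum_range_succ, Finset.mul_sum]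
    congr 1
    · refine Finset.sum_congr rfl fun j hj => ?_
      have := Finset.mem_range.1 hj
      rw [show m + 1 - 1 - j = m - 1 - j + 1 by omega, pow_succ]
      ring
    · simp

/-! ### Exponential generating functions -/

/-- The power series `e ^ (a x)`. -/
noncomputable abbrev expMul (a : ℚ) : PowerSeries ℚ :=
  PowerSeries.rescale a (PowerSeries.exp ℚ)

theorem coeff_expMul (a : ℚ) (n : ℕ) :
    PowerSeries.coeff n (expMul a) = a ^ n / n.factorial := by
  simp [PowerSeries.coeff_rescale, PowerSeries.coeff_exp, div_eq_mul_inv]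

/-- The unrolled recursion is a binomial convolution with the coefficients of `1 - e^{-(K+1)x}`. Its
constant term is 0, which removes the term `j = n`. -/
theorem factorial_mul_detCoeff (n K : ℕ) :
    (K.factorial * detCoeff n n K : ℚ) = n.factorial *
      PowerSeries.coeff n (∏ r ∈ Finset.range K, (1 - expMul (-(r + 1)))) := by
  induction K generalizing n with
  | zero =>
    cases n <;> simp [detCoeff, PowerSeries.coeff_one]
  | succ K ih =>
    rw [Finset.prod_range_succ, PowerSeries.coeff_mul,
      Finset.Nat.sum_antidiagonal_eq_sum_range_succ_mk, Finset.sum_range_succ,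
      detCoeff_succ_eq_sum]
    simp only [map_sub, coeff_expMul, PowerSeries.coeff_one, Nat.sub_self, Nat.factorial_succ]
    push_cast
    rw [Finset.mul_sum]
    simp only [pow_zero, Nat.factorial_zero, Nat.cast_one, div_one, sub_self, mul_zero,
      add_zero]
    rw [Finset.mul_sum]
    refine Finset.sum_congr rfl fun j hj => ?_
    have hj' := Finset.mem_range.1 hj
    rw [if_neg (by omega), Nat.cast_choose ℚ hj'.le]
    have h1 := ih j
    have hj0 : (j.factorial : ℚ) ≠ 0 := by positivity
    have hj1 : ((n - j).factorial : ℚ) ≠ 0 := by positivity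
    rw [show n - j = n - 1 - j + 1 by omega] at *
    rw [pow_succ]
    field_simp
    linear_combination ((-(K + 1 : ℚ)) ^ (n - 1 - j) * (K + 1)) * h1

/-- The exponential generating function of the staircase placements with `v` free rows. -/
noncomputable def staircaseSeries (v : ℕ) : PowerSeries ℚ :=
  PowerSeries.mk fun n => staircaseCount n v / n.factorial

theorem coeff_expMul_mul_staircaseSeries (v w n : ℕ) :
    PowerSeries.coeff n (expMul w * staircaseSeries v) =
      (∑ b ∈ Finset.range (n + 1), n.choose b * (w ^ b * staircaseCount (n - b) v) : ℕ) /
        n.factorial := by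
  rw [PowerSeries.coeff_mul, Finset.Nat.sum_antidiagonal_eq_sum_range_succ_mk, Nat.cast_sum,
    Finset.sum_div]
  refine Finset.sum_congr rfl fun b hb => ?_
  have hb' := Nat.lt_succ_iff.1 (Finset.mem_range.1 hb)
  have h : (n.factorial : ℚ) ≠ 0 := by positivity
  simp only [coeff_expMul, staircaseSeries, PowerSeries.coeff_mk]
  push_cast
  rw [Nat.cast_choose ℚ hb']
  field_simp

theorem expMul_mul_staircaseSeries (v : ℕ) :
    expMul v * staircaseSeries v + staircaseSeries (v + 1) =
      1 + expMul (v + 1 : ℕ) * staircaseSeries (v + 1) := by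
  ext n
  simp only [map_add, coeff_expMul_mul_staircaseSeries]
  by_cases hn : n = 0
  · subst hn
    simp [staircaseSeries, staircaseCount_zero]
  · rw [← sum_choose_staircaseCount hn, PowerSeries.coeff_one, if_neg hn, zero_add,
      staircaseSeries, PowerSeries.coeff_mk]
    push_cast
    rw [add_div]

theorem expMul_neg_mul_expMul (a : ℚ) : expMul (-a) * expMul a = 1 := by
  have h := PowerSeries.exp_mul_exp_eq_exp_add (A := ℚ) (-a) a
  rw [h]
  simp [PowerSeries.rescale_zero]

theorem expMul_mul_staircaseSeries_eq (v : ℕ) :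
    expMul v * staircaseSeries v =
      1 + (1 - expMul (-(v + 1))) * (expMul (v + 1 : ℕ) * staircaseSeries (v + 1)) := by
  have h := expMul_mul_staircaseSeries v
  have h' := expMul_neg_mul_expMul ((v + 1 : ℕ) : ℚ)
  push_cast at h h' ⊢
  linear_combination h + staircaseSeries (v + 1) * h'

/-- This is the recursion for `e^{vx} F_v` iterated `N` times; by `X_pow_dvd_prod` the remainder has
no coefficients below degree `N`. -/
theorem staircaseSeries_zero_eq (N : ℕ) :
    staircaseSeries 0 =
      ∑ K ∈ Finset.range N, ∏ r ∈ Finset.range K, (1 - expMul (-(r + 1))) +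
        (∏ r ∈ Finset.range N, (1 - expMul (-(r + 1)))) * (expMul N * staircaseSeries N) := by
  induction N with
  | zero => simp [show expMul 0 = 1 by simp [expMul]]
  | succ N ih =>
    rw [Finset.sum_range_succ, Finset.prod_range_succ, ih, expMul_mul_staircaseSeries_eq N]
    ring

theorem X_pow_dvd_prod (N : ℕ) :
    (PowerSeries.X : PowerSeries ℚ) ^ N ∣ ∏ r ∈ Finset.range N, (1 - expMul (-(r + 1))) := by
  have := Finset.prod_dvd_prod_of_dvd (s := Finset.range N) 
    (fun _ => (PowerSeries.X : PowerSeries ℚ)) (fun r => 1 - expMul (-((r : ℚ) + 1))) fun r _ => by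
      rw [PowerSeries.X_dvd_iff, ← PowerSeries.coeff_zero_eq_constantCoeff_apply, map_sub,
        coeff_expMul]
      simp
  simpa using this

theorem staircaseCount_zero_right (n : ℕ) :
    (staircaseCount n 0 : ℚ) = ∑ K ∈ Finset.range (n + 1), (n.factorial : ℚ) *
      PowerSeries.coeff n (∏ r ∈ Finset.range K, (1 - expMul (-((r : ℚ) + 1)))) := by
  have h := congrArg (PowerSeries.coeff n) (staircaseSeries_zero_eq (n + 1))
  rw [map_add, map_sum, PowerSeries.X_pow_dvd_iff.1 ((X_pow_dvd_prod (n + 1)).mul_right _) n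
    (Nat.lt_succ_self n), add_zero, staircaseSeries, PowerSeries.coeff_mk,
    div_eq_iff (by positivity)] at h
  rw [h, mul_comm, Finset.mul_sum]

theorem mainTheorem3 (n : ℕ) :
    (Nat.card {P : PartialOrder (Fin n) // IsIntervalOrder P} : ℤ) =
      ∑ S ∈ (Finset.Icc 1 (n - 1)).powerset,
        (binomMatrix n S).det *
          ∏ r ∈ Finset.Icc 1 (S.card + 1),
            (r : ℤ) ^ (extSeq n S r - extSeq n S (r - 1)) := by
  rw [sum_binomMatrix_det, card_isIntervalOrder, card_staircase, Fintype.card_fin]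
  have h := staircaseCount_zero_right n
  simp only [← factorial_mul_detCoeff] at h
  exact_mod_cast h
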